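/- **Setting.** Write $(a)_j=a(a+1)\cdots(a+j-1)$, $(a)_0=1$. Let $\mu\in[0,1)\cup i\mathbb{R}^+$ (ball, prolate and oblate spheroids). For $0\le m\le n$ and a sign $\pm$ (with $m\ge1$ for the sign $-$), put $\Phi_m^+(\phi)=\cos m\phi$, $\Phi_m^-(\phi)=\sin m\phi$. For $\mu\ne0$ the solid spheroidal harmonic $U^\pm_{n,m}[\mu]$ is the polynomial function on $\mathbb{R}^3$ given in spheroidal coordinates $$x_0=\mu\cos u\cosh v,\quad x_1=\mu\sin u\sinh v\cos\phi,\quad x_2=\mu\sin u\sinh v\sin\phi$$ ($u\in[0,\pi]$; $v\in[0,\infty)$ if $\mu$ is real, $v\in[0,\infty)-i\pi/2$ if $\mu$ is imaginary) by $$U^\pm_{n,m}[\mu](x)=\frac{(n-m)!}{2^n(1/2)_n}\,\mu^n P_n^m(\cos u)\,P_n^m(\cosh v)\,\Phi_m^\pm(\phi),$$ and for $\mu=0$, $U^\pm_{n,m}[0](x)=|x|^nP_n^m(x_0/|x|)\Phi_m^\pm(\phi)$. Here $P_n^m$ are the associated Legendre functions of the first kind: $P_n^m(t)=(-1)^m(1-t^2)^{m/2}P_n^{(m)}(t)$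 for $-1\le t\le1$, and $P_n^m(\cosh v)=(\sinh v)^mP_n^{(m)}(\cosh v)$, with $P_n$ the Legendre polynomial. The basic spheroidal monogenic polynomials are the functions, with values in $\mathbb{R}^3=\mathrm{span}(1,e_1,e_2)$ inside the quaternions, $$X^\pm_{n,m}[\mu]=\overline\partial\,U^\pm_{n+1,m}[\mu],\qquad \overline\partial=\frac{\partial}{\partial x_0}-e_1\frac{\partial}{\partial x_1}-e_2\frac{\partial}{\partial x_2},\qquad n\ge-1,\ 0\le m\le n+1$$ (so $X^+_{-1,0}[\mu]=\overline\partial 1=0$). Define $$u_{n,m,k}=\frac{(1/2)_{n-k}(n+m-2k+1)_{2k}}{(-4)^k(1/2)_n\,k!},\qquad u^0_{n,m,k}=\frac{4^{n-2k}(2n-4k+1)(n-k)!\,(m+n)!\,(1/2)_{n-2k}}{k!\,(2n-2k+1)!\,(n+m-2k)!},$$ $$v_{n,m,k}=u_{n+1,m,k},\qquad v^0_{n,m,k}=u^0_{n+1,m,k},\qquad w_{n,m,k}=\frac{(n+m+1)!\,(1/2)_{n-2k+2}}{4^kk!\,(n+m-2k+1)!\,(1/2)_{n-k+2}},$$ $$v_{n,m,k}[\tilde\mu,\mu]={}_2F_1\bigl(-k,-n+k-\tfrac32;-n-\tfrac12;(\tilde\mu/\mu)^2\bigr)\,w_{n,m,k}\,\mu^{2k}\quad(\mu\neq0),$$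 and for $\mu=0$ the limiting value $v_{n,m,k}[\tilde\mu,0]=v_{n,m,k}\,\tilde\mu^{2k}$. **Theorem.** Let $n\ge0$, $0\le m\le n+1$, and let the sign be $\pm$ (with $m\ge1$ for the sign $-$). For all $\mu,\tilde\mu\in[0,1)\cup i\mathbb{R}^+$, identically on $\mathbb{R}^3$, $$X^\pm_{n,m}[\mu]=\sum_{0\le2k\le n-m+1}v_{n,m,k}\,\mu^{2k}\,X^\pm_{n-2k,m}[0],$$ $$X^\pm_{n,m}[0]=\sum_{0\le2k\le n-m+1}v^0_{n,m,k}\,\mu^{2k}\,X^\pm_{n-2k,m}[\mu],$$ $$X^\pm_{n,m}[\tilde\mu]=\sum_{0\le2k\le n-m+1}v_{n,m,k}[\tilde\mu,\mu]\,X^\pm_{n-2k,m}[\mu].$$ -/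

import Mathlib

open scoped Quaternion

namespace Spheroidal

/-- Three-dimensional Euclidean space, with coordinates `x 0, x 1, x 2`. -/
abbrev E3 : Type := EuclideanSpace ℝ (Fin 3)

/-- The distance `√(x₁² + x₂²)` of `x` to the axis of revolution. -/
noncomputable def axialDist (x : E3) : ℝ := √(x 1 ^ 2 + x 2 ^ 2)

/-- The azimuth `φ` of `x`, so that `x₁ = √(x₁² + x₂²) cos φ` and `x₂ = √(x₁² + x₂²) sin φ`.
Only `cos (m φ)` and `sin (m φ)` are used, hence only `φ` modulo `2π` matters. -/
noncomputable def azimuth (x : E3) : ℝ := Complex.arg ⟨x 1, x 2⟩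

/-- The two parities, for the superscripts `+` (cosine) and `-` (sine). -/
inductive Parity : Type
  | plus : Parity
  | minus : Parity

/-- `Φ_m^+(φ) = cos (m φ)` and `Φ_m^-(φ) = sin (m φ)`. -/
noncomputable def angular (s : Parity) (m : ℕ) (φ : ℝ) : ℝ :=
  match s with
  | Parity.plus => Real.cos (m * φ)
  | Parity.minus => Real.sin (m * φ)

/-- The admissible parameters `μ ∈ [0, 1) ∪ i ℝ⁺`: the ball for `μ = 0`, prolate spheroids for
`0 < μ < 1`, and oblate spheroids for `μ / i > 0`. -/
def params : Set ℂ :=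
  {μ | (∃ r : ℝ, 0 ≤ r ∧ r < 1 ∧ μ = (r : ℂ)) ∨ (∃ r : ℝ, 0 < r ∧ μ = (r : ℂ) * Complex.I)}

/-- The Legendre polynomial `P_n`, by Rodrigues' formula. -/
noncomputable def legendre (n : ℕ) : Polynomial ℝ :=
  Polynomial.C ((2 ^ n * (n.factorial : ℝ))⁻¹) *
    Polynomial.derivative^[n] ((Polynomial.X ^ 2 - 1) ^ n)

/-- The associated Legendre function `P_n^m(t) = (-1)^m (1 - t²)^{m/2} P_n^{(m)}(t)`
on the cut `-1 ≤ t ≤ 1`. -/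
noncomputable def legendreOnCut (n m : ℕ) (t : ℝ) : ℝ :=
  (-1) ^ m * √(1 - t ^ 2) ^ m * (Polynomial.derivative^[m] (legendre n)).eval t

/-- The associated Legendre function `P_n^m(z) = (z² - 1)^{m/2} P_n^{(m)}(z)` off the cut,
at `z = cosh v`, with the branch `(z² - 1)^{1/2} = sinh v`. -/
noncomputable def legendreAtCosh (n m : ℕ) (v : ℂ) : ℂ :=
  Complex.sinh v ^ m * Polynomial.aeval (Complex.cosh v) (Polynomial.derivative^[m] (legendre n))

/-- The Pochhammer symbol `(a)_n = a (a + 1) ⋯ (a + n - 1)`. -/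
noncomputable def poch (a : ℝ) (n : ℕ) : ℝ := (ascPochhammer ℝ n).eval a

/-- `(u, v)` are spheroidal coordinates of `x` for the parameter `μ ≠ 0`; together with the
azimuth `φ` this says `x₀ = μ cos u cosh v`, `x₁ = μ sin u sinh v cos φ`,
`x₂ = μ sin u sinh v sin φ`. In the prolate case `v` is real and nonnegative; in the oblate
case `v` lies on the half-line `[0, ∞) - i π / 2`. -/
def IsSpheroidalCoords (μ : ℂ) (x : E3) (u : ℝ) (v : ℂ) : Prop :=
  0 ≤ u ∧ u ≤ Real.pi ∧ 0 ≤ v.re ∧ v.im = (if μ.im = 0 then 0 else -(Real.pi / 2)) ∧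
    (x 0 : ℂ) = μ * (Real.cos u : ℂ) * Complex.cosh v ∧
    (axialDist x : ℂ) = μ * (Real.sin u : ℂ) * Complex.sinh v

theorem exists_prolate (a y ρ : ℝ) (ha : 0 < a) (hρ : 0 ≤ ρ) : ∃ u w : ℝ,
    0 ≤ u ∧ u ≤ Real.pi ∧ 0 ≤ w ∧ y = a * Real.cos u * Real.cosh w ∧
      ρ = a * Real.sin u * Real.sinh w := by
  set S : ℝ := y ^ 2 + ρ ^ 2 + a ^ 2 with hS
  have hD0 : 0 ≤ S ^ 2 - 4 * a ^ 2 * y ^ 2 := by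
    have : S ^ 2 - 4 * a ^ 2 * y ^ 2 = ((y + a) ^ 2 + ρ ^ 2) * ((y - a) ^ 2 + ρ ^ 2) := by
      rw [hS]; ring
    rw [this]; positivity
  set D : ℝ := √(S ^ 2 - 4 * a ^ 2 * y ^ 2) with hD
  have hDn : 0 ≤ D := Real.sqrt_nonneg _
  have hDD : D ^ 2 = S ^ 2 - 4 * a ^ 2 * y ^ 2 := Real.sq_sqrt hD0
  have habs : |S - 2 * a ^ 2| ≤ D := by
    apply abs_le_of_sq_le_sq _ hDn
    nlinarith [sq_nonneg (a * ρ)]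
  obtain ⟨h1, h2⟩ := abs_le.mp habs
  have ha2 : 0 < a ^ 2 := by positivity
  have hC2 : 1 ≤ (S + D) / (2 * a ^ 2) := by rw [le_div_iff₀ (by positivity)]; linarith
  set C : ℝ := √((S + D) / (2 * a ^ 2)) with hC
  have hCC : C ^ 2 = (S + D) / (2 * a ^ 2) := Real.sq_sqrt (by linarith)
  have hC1 : 1 ≤ C := by rw [hC]; exact Real.one_le_sqrt.mpr hC2
  have hCpos : 0 < C := by linarith
  set c : ℝ := y / (a * C) with hc
  have hcy : a * c * C = y := by rw [hc]; field_simp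
  have hcc : c ^ 2 = (S - D) / (2 * a ^ 2) := by
    have hne : (S + D) ≠ 0 := by
      have : 0 < (S + D) / (2 * a ^ 2) := by linarith
      intro h; rw [h] at this; simp at this
    have : c ^ 2 = y ^ 2 / (a ^ 2 * C ^ 2) := by rw [hc]; ring
    rw [this, hCC]
    field_simp
    linear_combination hDD
  have hc1 : c ^ 2 ≤ 1 := by rw [hcc, div_le_one (by positivity)]; linarith
  have hprod : (1 - c ^ 2) * (C ^ 2 - 1) = (ρ / a) ^ 2 := by
    rw [hcc, hCC]
    field_simp
    linear_combination hDD + (4 * a ^ 2) * hS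
  obtain ⟨hcl, hcu⟩ := abs_le.mp ((sq_le_one_iff_abs_le_one c).mp hc1)
  refine ⟨Real.arccos c, Real.arcosh C, Real.arccos_nonneg _, Real.arccos_le_pi _,
    Real.arcosh_nonneg hC1, ?_, ?_⟩
  · rw [Real.cos_arccos hcl hcu, Real.cosh_arcosh hC1, hcy]
  · rw [Real.sin_arccos, Real.sinh_arcosh hC1, mul_assoc, ← Real.sqrt_mul (by linarith), hprod,
      Real.sqrt_sq (by positivity)]
    field_simp

theorem exists_oblate (a y ρ : ℝ) (ha : 0 < a) (hρ : 0 ≤ ρ) : ∃ u w : ℝ,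
    0 ≤ u ∧ u ≤ Real.pi ∧ 0 ≤ w ∧ y = a * Real.cos u * Real.sinh w ∧
      ρ = a * Real.sin u * Real.cosh w := by
  set S : ℝ := y ^ 2 + ρ ^ 2 - a ^ 2 with hS
  have hD0 : 0 ≤ S ^ 2 + 4 * a ^ 2 * y ^ 2 := by positivity
  set D : ℝ := √(S ^ 2 + 4 * a ^ 2 * y ^ 2) with hD
  have hDn : 0 ≤ D := Real.sqrt_nonneg _
  have hDD : D ^ 2 = S ^ 2 + 4 * a ^ 2 * y ^ 2 := Real.sq_sqrt hD0
  have habs : |S| ≤ D := by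
    apply abs_le_of_sq_le_sq _ hDn
    nlinarith [sq_nonneg (a * y)]
  obtain ⟨h1, h2⟩ := abs_le.mp habs
  have hup : D ≤ S + 2 * a ^ 2 := by
    have h3 : 0 ≤ S + 2 * a ^ 2 := by
      rw [hS]; nlinarith [sq_nonneg y, sq_nonneg ρ, sq_nonneg a]
    apply (sq_le_sq₀ hDn h3).mp
    nlinarith [sq_nonneg (a * ρ)]
  have ha2 : 0 < a ^ 2 := by positivity
  set s : ℝ := √((S + D) / (2 * a ^ 2)) with hs
  have hss : s ^ 2 = (S + D) / (2 * a ^ 2) := Real.sq_sqrt (div_nonneg (by linarith) (by positivity))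
  have hs0 : 0 ≤ s := Real.sqrt_nonneg _
  set b : ℝ := √((D - S) / (2 * a ^ 2)) with hb
  have hbb : b ^ 2 = (D - S) / (2 * a ^ 2) := Real.sq_sqrt (div_nonneg (by linarith) (by positivity))
  have hb0 : 0 ≤ b := Real.sqrt_nonneg _
  have hbs : a * b * s = |y| := by
    rw [← abs_of_nonneg (show 0 ≤ a * b * s by positivity)]
    apply (sq_eq_sq_iff_abs_eq_abs _ _).mp
    rw [mul_pow, mul_pow, hbb, hss]
    field_simp
    linear_combination hDD
  obtain ⟨c, hcb, hcy⟩ : ∃ c : ℝ, c ^ 2 = b ^ 2 ∧ a * c * s = y := by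
    rcases le_total 0 y with h | h
    · exact ⟨b, rfl, by rw [hbs, abs_of_nonneg h]⟩
    · refine ⟨-b, by ring, ?_⟩
      rw [abs_of_nonpos h] at hbs
      linarith
  have hc1 : c ^ 2 ≤ 1 := by rw [hcb, hbb, div_le_one (by positivity)]; linarith
  have hprod : (1 - c ^ 2) * (1 + s ^ 2) = (ρ / a) ^ 2 := by
    rw [hcb, hbb, hss]
    field_simp
    linear_combination (-1) * hDD + (4 * a ^ 2) * hS
  obtain ⟨hcl, hcu⟩ := abs_le.mp ((sq_le_one_iff_abs_le_one c).mp hc1)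
  refine ⟨Real.arccos c, Real.arsinh s, Real.arccos_nonneg _, Real.arccos_le_pi _,
    Real.arsinh_nonneg_iff.mpr hs0, ?_, ?_⟩
  · rw [Real.cos_arccos hcl hcu, Real.sinh_arsinh, hcy]
  · rw [Real.sin_arccos, Real.cosh_arsinh, mul_assoc, ← Real.sqrt_mul (by linarith), hprod,
      Real.sqrt_sq (by positivity)]
    field_simp

/-- Every point of space has spheroidal coordinates. -/
theorem exists_spheroidalCoords {μ : ℂ} (hμ : μ ∈ params) (h0 : μ ≠ 0) (x : E3) :
    ∃ p : ℝ × ℂ, IsSpheroidalCoords μ x p.1 p.2 := by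
  have hρ : 0 ≤ axialDist x := Real.sqrt_nonneg _
  rcases hμ with ⟨r, hr, -, rfl⟩ | ⟨r, hr, rfl⟩
  · have hr' : 0 < r := lt_of_le_of_ne hr (by rintro rfl; simp at h0)
    obtain ⟨u, w, hu, hu', hw, hy, hq⟩ := exists_prolate r (x 0) (axialDist x) hr' hρ
    refine ⟨(u, (w : ℂ)), hu, hu', by simpa using hw, by simp, ?_, ?_⟩
    · rw [hy]; push_cast; ring
    · rw [hq]; push_cast; ring
  · obtain ⟨u, w, hu, hu', hw, hy, hq⟩ := exists_oblate r (x 0) (axialDist x) hr hρ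
    have hcosh : Complex.cosh ((w : ℂ) - (Real.pi / 2 : ℝ) * Complex.I)
        = -(Real.sinh w : ℂ) * Complex.I := by
      rw [Complex.cosh_sub, Complex.cosh_mul_I, Complex.sinh_mul_I, ← Complex.ofReal_cos,
        ← Complex.ofReal_sin]
      simp
    have hsinh : Complex.sinh ((w : ℂ) - (Real.pi / 2 : ℝ) * Complex.I)
        = -(Real.cosh w : ℂ) * Complex.I := by
      rw [Complex.sinh_sub, Complex.cosh_mul_I, Complex.sinh_mul_I, ← Complex.ofReal_cos,
        ← Complex.ofReal_sin]
      simp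
    refine ⟨(u, (w : ℂ) - (Real.pi / 2 : ℝ) * Complex.I), hu, hu', by simpa using hw,
      by simp [hr.ne'], ?_, ?_⟩
    · rw [hcosh, hy]; push_cast
      linear_combination ((r : ℂ) * Complex.cos u * Complex.sinh w) * Complex.I_sq
    · rw [hsinh, hq]; push_cast
      linear_combination ((r : ℂ) * Complex.sin u * Complex.cosh w) * Complex.I_sq

/-- The factor `U_{n,m}[μ](u, v) = (n-m)! / (2^n (1/2)_n) μ^n P_n^m(cos u) P_n^m(cosh v)`. -/
noncomputable def harmonicFactor (μ : ℂ) (n m : ℕ) (u : ℝ) (v : ℂ) : ℂ :=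
  (((n - m).factorial / (2 ^ n * poch (1 / 2) n) : ℝ) : ℂ) * μ ^ n *
    (legendreOnCut n m (Real.cos u) : ℂ) * legendreAtCosh n m v

open Classical in
/-- The solid spheroidal harmonic `U^±_{n,m}[μ]`, for `m ≤ n`: for `μ ≠ 0` it is
`U_{n,m}[μ](u, v) Φ_m^±(φ)` at the point with spheroidal coordinates `(u, v, φ)` (a real number,
although `μ` and `v` are not real for oblate spheroids), and for `μ = 0` it is the classical solid
spherical harmonic `|x|^n P_n^m(x₀ / |x|) Φ_m^±(φ)`. -/
noncomputable def solidHarmonic (μ : ℂ) (s : Parity) (n m : ℕ) (x : E3) : ℝ :=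
  if μ = 0 then
    ‖x‖ ^ n * legendreOnCut n m (x 0 / ‖x‖) * angular s m (azimuth x)
  else if h : ∃ p : ℝ × ℂ, IsSpheroidalCoords μ x p.1 p.2 then
    (harmonicFactor μ n m h.choose.1 h.choose.2).re * angular s m (azimuth x)
  else 0

/-- The partial derivative `∂f/∂x_i`. -/
noncomputable def partialDeriv (i : Fin 3) (f : E3 → ℝ) (x : E3) : ℝ :=
  lineDeriv ℝ f x (EuclideanSpace.single i 1)

/-- `∂̄ f = ∂f/∂x₀ - e₁ ∂f/∂x₁ - e₂ ∂f/∂x₂`, for a real-valued function `f`. -/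
noncomputable def conjDirac (f : E3 → ℝ) (x : E3) : ℍ[ℝ] :=
  ⟨partialDeriv 0 f x, -partialDeriv 1 f x, -partialDeriv 2 f x, 0⟩

/-- The basic spheroidal monogenic polynomial `X^±_{n,m}[μ] = ∂̄ U^±_{n+1,m}[μ]`, for an integer
`n ≥ -1` and `0 ≤ m ≤ n + 1` (`X^+_{-1,0}[μ] = ∂̄ U^+_{0,0}[μ]` is zero). -/
noncomputable def monogenic (μ : ℂ) (s : Parity) (n : ℤ) (m : ℕ) : E3 → ℍ[ℝ] :=
  conjDirac (solidHarmonic μ s (n + 1).toNat m)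

/-- `u_{n,m,k}`. -/
noncomputable def coeffU (n m k : ℕ) : ℝ :=
  if m ≤ n ∧ 2 * k ≤ n then
    poch (1 / 2) (n - k) * poch ((n : ℝ) + m - 2 * k + 1) (2 * k) /
      ((-4) ^ k * poch (1 / 2) n * k.factorial)
  else 0

/-- `u⁰_{n,m,k}`, for `m ≤ n` and `2 k ≤ n - m`. -/
noncomputable def coeffUInv (n m k : ℕ) : ℝ :=
  4 ^ (n - 2 * k) * (2 * (n : ℝ) - 4 * k + 1) * (n - k).factorial * (m + n).factorial *
      poch (1 / 2) (n - 2 * k) /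
    (k.factorial * (2 * n - 2 * k + 1).factorial * (n + m - 2 * k).factorial)

/-- `v_{n,m,k} = u_{n+1,m,k}`. -/
noncomputable def coeffV (n m k : ℕ) : ℝ := coeffU (n + 1) m k

/-- `v⁰_{n,m,k} = u⁰_{n+1,m,k}`. -/
noncomputable def coeffVInv (n m k : ℕ) : ℝ := coeffUInv (n + 1) m k

/-- `w_{n,m,k}`, for `2 k ≤ n - m + 1`. -/
noncomputable def coeffW (n m k : ℕ) : ℝ :=
  (n + m + 1).factorial * poch (1 / 2) (n + 2 - 2 * k) /
    (4 ^ k * k.factorial * (n + m + 1 - 2 * k).factorial * poch (1 / 2) (n + 2 - k))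

open Classical in
/-- The conversion coefficient
`v_{n,m,k}[μ', μ] = ₂F₁(-k, -n + k - 3/2; -n - 1/2; (μ'/μ)²) w_{n,m,k} μ^{2k}` for `μ ≠ 0`, and its
limit `v_{n,m,k} μ'^{2k}` for `μ = 0`. For admissible `μ, μ'` the powers involved are real. -/
noncomputable def coeffConv (n m k : ℕ) (μ' μ : ℂ) : ℝ :=
  if μ = 0 then coeffV n m k * (μ' ^ (2 * k)).re
  else
    ordinaryHypergeometric (-(k : ℝ)) (-(n : ℝ) + k - 3 / 2) (-(n : ℝ) - 1 / 2)
        (((μ' / μ) ^ 2).re : ℝ) *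
      coeffW n m k * (μ ^ (2 * k)).re

end Spheroidal

open Spheroidal

/-! Everything reduces to expanding a spheroidal harmonic in spherical ones. Put t = cos u, z = cosh
v, let Q be the m-th derivative of P_{N+m}, and homogenize Q to F_N(a, b) = ∑ q_i a^(N-2i) b^i.
Since x₀ = μtz and |x|² = μ²(t² + z² - 1), the spherical harmonic of degree N + m is ρ^m F_N(x₀,
|x|²) times the angular factor and (-1)^m. The expansion thus amounts to the polynomial identity
(`gegenbauerForm_product`) c Q(t) Q(z) = ∑ u_k F_{N-2k}(tz, t² + z² - 1).

With L the Gegenbauer operator, both sides satisfy L_t G = L_z G: on the left because t and z share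
one eigenvalue, on the right by the recursion for the q_i. As t = 1 is a singular point of L_t, such
a polynomial G is determined by its restriction to t = 1 (`eq_zero_of_gegenbauerOp_eq`). There
F_{N-2k}(z, z²) is a multiple of z^(N-2k), and comparing coefficients gives the u_k.

The inverse expansion follows from a telescoping sum (`sum_poch_telescope`). Passing from μ' to 0
and on to μ convolves the two families of coefficients, and the convolution is a terminating ₂F₁
(`coeffU_mul_coeffUInv`). Finally ∂̄ is applied term by term. -/

namespace Spheroidal

open Polynomial

/-! ### The Gegenbauer operator in two variables -/

section Operator

variable {A : Type*} [CommRing A] [Algebra ℝ A]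

/-- The Gegenbauer operator `(1 - t²) d² - 2 (m + 1) t d` for a derivation `d`. -/
noncomputable def gegenbauerOp (m : ℕ) (d : Derivation ℝ A A) (t : A) : A →ₗ[ℝ] A :=
  LinearMap.mulLeft ℝ (1 - t ^ 2) ∘ₗ d.toLinearMap ∘ₗ d.toLinearMap -
    LinearMap.mulLeft ℝ (2 * (m + 1) * t) ∘ₗ d.toLinearMap

theorem gegenbauerOp_apply (m : ℕ) (d : Derivation ℝ A A) (t f : A) :
    gegenbauerOp m d t f = (1 - t ^ 2) * d (d f) - 2 * (m + 1) * t * d f := by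
  simp [gegenbauerOp, mul_assoc]

/-- In the variables a = tz, b = t² + z² - 1 the operator L_t - L_z becomes z² - t² times ∂_a² +
4a∂_a∂_b + 4b∂_b² + (4m + 6)∂_b. The truncated exponents p - 2 and i - 1 are harmless, because p(p -
1) or i vanishes whenever truncation occurs. -/
theorem gegenbauerOp_sub_monomial (m : ℕ) (d e : Derivation ℝ A A) (t z : A)
    (dt : d t = 1) (dz : d z = 0) (et : e t = 0) (ez : e z = 1) (p i : ℕ) :
    gegenbauerOp m d t ((t * z) ^ p * (t ^ 2 + z ^ 2 - 1) ^ i) -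
      gegenbauerOp m e z ((t * z) ^ p * (t ^ 2 + z ^ 2 - 1) ^ i) =
    (z ^ 2 - t ^ 2) * (p * (p - 1) * ((t * z) ^ (p - 2) * (t ^ 2 + z ^ 2 - 1) ^ i) +
      2 * i * (2 * p + 2 * i + 2 * m + 1) * ((t * z) ^ p * (t ^ 2 + z ^ 2 - 1) ^ (i - 1))) := by
  have da : d (t * z) = z := by simp [dt, dz]
  have ea : e (t * z) = t := by simp [et, ez]
  have db : d (t ^ 2 + z ^ 2 - 1) = 2 * t := by simp [dt, dz, Derivation.leibniz_pow]
  have eb : e (t ^ 2 + z ^ 2 - 1) = 2 * z := by simp [et, ez, Derivation.leibniz_pow]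
  have d2 : d 2 = 0 := by simpa using d.map_natCast 2
  have e2 : e 2 = 0 := by simpa using e.map_natCast 2
  have h2 : (1 - t ^ 2) * t ^ 2 - (1 - z ^ 2) * z ^ 2 =
      (z ^ 2 - t ^ 2) * (t ^ 2 + z ^ 2 - 1) := by ring
  simp only [gegenbauerOp_apply]
  generalize t ^ 2 + z ^ 2 - 1 = b at *
  generalize ha : t * z = a at da ea ⊢
  rcases p with _ | _ | p <;> rcases i with _ | _ | i <;>
    simp [Derivation.leibniz, Derivation.leibniz_pow, da, db, ea, eb, dt, dz, et, ez, d2, e2]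
  · ring
  · linear_combination 4 * (i + 2) * (i + 1) * b ^ i * h2
  · ring
  · linear_combination 4 * (z ^ 2 - t ^ 2) * ha
  · linear_combination 4 * (i + 2) * (i + 1) * a * b ^ i * h2 +
      4 * (i + 2) * b ^ (i + 1) * (z ^ 2 - t ^ 2) * ha
  · ring
  · linear_combination 4 * (p + 2) * a ^ (p + 1) * (z ^ 2 - t ^ 2) * ha
  · linear_combination 4 * (i + 2) * (i + 1) * a ^ (p + 2) * b ^ i * h2 +
      4 * (p + 2) * (i + 2) * a ^ (p + 1) * b ^ (i + 1) * (z ^ 2 - t ^ 2) * ha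

end Operator

/-! ### Coefficients and homogenization of Legendre derivatives -/

/-- The coefficient of `X ^ (N - 2 i)` in the `m`-th derivative of the Legendre polynomial of
degree `N + m`. -/
noncomputable def gegenbauerCoeff (m N i : ℕ) : ℝ :=
  (-1) ^ i * (N + m).choose i * (2 * (N + m - i)).factorial /
    (2 ^ (N + m) * (N + m).factorial * (N - 2 * i).factorial)

theorem gegenbauerCoeff_succ (m N i : ℕ) (h : 2 * i + 2 ≤ N) :
    gegenbauerCoeff m N i * (((N - 2 * i : ℕ) : ℝ) * (((N - 2 * i : ℕ) : ℝ) - 1)) +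
      gegenbauerCoeff m N (i + 1) *
        (2 * ((i : ℝ) + 1) * (2 * ((N - 2 * (i + 1) : ℕ) : ℝ) + 2 * (i + 1) + 2 * m + 1)) = 0 := by
  obtain ⟨M, rfl⟩ := Nat.exists_eq_add_of_le h
  have e1 : 2 * i + 2 + M - 2 * i = M + 2 := by omega
  have e2 : 2 * i + 2 + M - 2 * (i + 1) = M := by omega
  have e3 : 2 * (2 * i + 2 + M + m - i) = 2 * (i + 1 + M + m) + 2 := by omega
  have e4 : 2 * (2 * i + 2 + M + m - (i + 1)) = 2 * (i + 1 + M + m) := by omega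
  have hc : ((2 * i + 2 + M + m).choose (i + 1) : ℝ) * (i + 1) =
      (2 * i + 2 + M + m).choose i * (i + 2 + M + m) := by
    have := Nat.choose_succ_right_eq (2 * i + 2 + M + m) i
    rw [show 2 * i + 2 + M + m - i = i + 2 + M + m by omega] at this
    exact_mod_cast this
  simp only [gegenbauerCoeff, e1, e2, e3, e4, Nat.factorial_succ]
  push_cast
  have h1 : (M.factorial : ℝ) ≠ 0 := by positivity
  have h2 : ((2 * i + 2 + M + m).factorial : ℝ) ≠ 0 := by positivity
  have h3 : (M : ℝ) + 1 + 1 ≠ 0 := by positivity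
  have h4 : (M : ℝ) + 1 ≠ 0 := by positivity
  field_simp
  rw [pow_succ]
  linear_combination (-2) * ((2 * (i + 1 + M + m)).factorial : ℝ) * (-1 : ℝ) ^ i *
    (2 * i + 2 + 2 * M + 2 * m + 1) * (M + 1 + 1) * (M + 1) * hc

/-- The first part of term i cancels the second part of term i + 1. Since f is arbitrary, one
cancellation serves twice: f p i = t^p gives the Gegenbauer equation of Q, and f p i = (tz)^p (t² +
z² - 1)^i gives L_t = L_z on the form. -/
theorem sum_gegenbauerCoeff_smul_eq_zero {V : Type*} [AddCommGroup V] [Module ℝ V] (m N : ℕ)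
    (f : ℕ → ℕ → V) :
    ∑ i ∈ Finset.range (N / 2 + 1), gegenbauerCoeff m N i •
      ((((N - 2 * i : ℕ) : ℝ) * (((N - 2 * i : ℕ) : ℝ) - 1)) • f (N - 2 * i - 2) i +
        (2 * (i : ℝ) * (2 * ((N - 2 * i : ℕ) : ℝ) + 2 * i + 2 * m + 1)) •
          f (N - 2 * i) (i - 1)) = 0 := by
  simp only [smul_add, Finset.sum_add_distrib, smul_smul]
  rw [Finset.sum_range_succ, Finset.sum_range_succ' (fun i : ℕ => (gegenbauerCoeff m N i * (2 *
    (i : ℝ) * (2 * ((N - 2 * i : ℕ) : ℝ) + 2 * i + 2 * m + 1))) • f (N - 2 * i) (i - 1))]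
  -- The unpaired last term has exponent p = 0 or 1, so p(p - 1) = 0.
  have h0 : ((N - 2 * (N / 2) : ℕ) : ℝ) * (((N - 2 * (N / 2) : ℕ) : ℝ) - 1) = 0 := by
    have : N - 2 * (N / 2) = 0 ∨ N - 2 * (N / 2) = 1 := by omega
    rcases this with h | h <;> simp [h]
  rw [h0]
  simp only [mul_zero, zero_smul, add_zero, Nat.cast_zero, zero_mul, ← Finset.sum_add_distrib]
  refine Finset.sum_eq_zero fun i hi => ?_
  have hi' : 2 * i + 2 ≤ N := by have := Finset.mem_range.mp hi; omega
  rw [show N - 2 * i - 2 = N - 2 * (i + 1) by omega, Nat.add_sub_cancel, ← add_smul]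
  have := gegenbauerCoeff_succ m N i hi'
  push_cast
  rw [this, zero_smul]

section Form

variable {A : Type*} [CommRing A] [Algebra ℝ A]

/-- The binary form `∑ q_i a^(N - 2 i) b^i`, where `∑ q_i X^(N - 2 i)` is the `m`-th derivative of
the Legendre polynomial of degree `N + m`. -/
noncomputable def gegenbauerForm (m N : ℕ) (a b : A) : A :=
  ∑ i ∈ Finset.range (N / 2 + 1), gegenbauerCoeff m N i • (a ^ (N - 2 * i) * b ^ i)

theorem map_gegenbauerForm {B : Type*} [CommRing B] [Algebra ℝ B] (φ : A →ₐ[ℝ] B) (m N : ℕ)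
    (a b : A) : φ (gegenbauerForm m N a b) = gegenbauerForm m N (φ a) (φ b) := by
  simp [gegenbauerForm]

/-- Weighted homogeneity, with a of weight 1 and b of weight 2; it extracts the powers of ‖x‖ and of
μ and evaluates the form on t = 1. -/
theorem gegenbauerForm_mul (m N : ℕ) (r a b : A) :
    gegenbauerForm m N (r * a) (r ^ 2 * b) = r ^ N * gegenbauerForm m N a b := by
  simp only [gegenbauerForm, Finset.mul_sum]
  refine Finset.sum_congr rfl fun i hi => ?_
  have hi' : N = N - 2 * i + 2 * i := by have := Finset.mem_range.mp hi; omega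
  rw [mul_smul_comm]
  congr 1
  conv_rhs => rw [hi', pow_add, pow_mul]
  simp only [Nat.add_sub_cancel]
  ring

theorem gegenbauerOp_form (m N : ℕ) (d : Derivation ℝ A A) (t : A) (dt : d t = 1) :
    gegenbauerOp m d t (gegenbauerForm m N t 1) =
      (-((N : ℝ) * (N + 2 * m + 1))) • gegenbauerForm m N t 1 := by
  rw [← sub_eq_zero, ← sum_gegenbauerCoeff_smul_eq_zero m N (fun p _ => t ^ p)]
  simp only [gegenbauerForm, map_sum, map_smul, Finset.smul_sum, one_pow, mul_one]
  rw [← Finset.sum_sub_distrib]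
  refine Finset.sum_congr rfl fun i hi => ?_
  rw [smul_comm, ← smul_sub]
  congr 1
  have hi' : N = N - 2 * i + 2 * i := by have := Finset.mem_range.mp hi; omega
  generalize N - 2 * i = p at *
  subst hi'
  have c2 : algebraMap ℝ A 2 = 2 := map_ofNat _ 2
  simp only [Algebra.smul_def, gegenbauerOp_apply]
  rcases p with _ | _ | p <;> simp [Derivation.leibniz, Derivation.leibniz_pow, dt, c2] <;> ring

theorem gegenbauerOp_sub_form (m N : ℕ) (d e : Derivation ℝ A A) (t z : A)
    (dt : d t = 1) (dz : d z = 0) (et : e t = 0) (ez : e z = 1) :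
    gegenbauerOp m d t (gegenbauerForm m N (t * z) (t ^ 2 + z ^ 2 - 1)) =
      gegenbauerOp m e z (gegenbauerForm m N (t * z) (t ^ 2 + z ^ 2 - 1)) := by
  rw [← sub_eq_zero, ← mul_zero (z ^ 2 - t ^ 2), ← sum_gegenbauerCoeff_smul_eq_zero m N
    (fun p i => (t * z) ^ p * (t ^ 2 + z ^ 2 - 1) ^ i)]
  simp only [gegenbauerForm, map_sum, map_smul, Finset.mul_sum, ← Finset.sum_sub_distrib,
    ← smul_sub, gegenbauerOp_sub_monomial m d e t z dt dz et ez, mul_smul_comm]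
  have c2 : algebraMap ℝ A 2 = 2 := map_ofNat _ 2
  simp [Algebra.smul_def, c2]

theorem gegenbauerOp_mul (m : ℕ) (d : Derivation ℝ A A) (t f g : A) (dg : d g = 0) :
    gegenbauerOp m d t (f * g) = gegenbauerOp m d t f * g := by
  simp [gegenbauerOp_apply, Derivation.leibniz, dg]
  ring

theorem derivation_gegenbauerForm_eq_zero (m N : ℕ) (d : Derivation ℝ A A) (t : A) (dt : d t = 0) :
    d (gegenbauerForm m N t 1) = 0 := by
  simp [gegenbauerForm, Derivation.leibniz_pow, dt]

/-- Each operator sees only its own factor, and the eigenvalue -N(N + 2m + 1) is the same for both.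
-/
theorem gegenbauerOp_form_mul_form (m N : ℕ) (d e : Derivation ℝ A A) (t z : A)
    (dt : d t = 1) (dz : d z = 0) (et : e t = 0) (ez : e z = 1) :
    gegenbauerOp m d t (gegenbauerForm m N t 1 * gegenbauerForm m N z 1) =
      gegenbauerOp m e z (gegenbauerForm m N t 1 * gegenbauerForm m N z 1) := by
  rw [gegenbauerOp_mul _ _ _ _ _ (derivation_gegenbauerForm_eq_zero m N d z dz),
    mul_comm (gegenbauerForm m N t 1) (gegenbauerForm m N z 1),
    gegenbauerOp_mul _ _ _ _ _ (derivation_gegenbauerForm_eq_zero m N e t et),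
    gegenbauerOp_form m N d t dt, gegenbauerOp_form m N e z ez]
  rw [smul_mul_assoc, smul_mul_assoc, mul_comm (gegenbauerForm m N t 1)]

end Form

/-! ### Rodrigues' formula and the value at 1 -/

theorem iterate_derivative_legendre (m N : ℕ) :
    derivative^[m] (legendre (N + m)) = gegenbauerForm m N X 1 := by
  have h : (X ^ 2 - 1 : ℝ[X]) ^ (N + m) = ∑ i ∈ Finset.range (N + m + 1),
      C ((-1) ^ i * ((N + m).choose i : ℝ)) * X ^ (2 * (N + m - i)) := by
    rw [sub_eq_neg_add, add_pow]
    refine Finset.sum_congr rfl fun i _ => ?_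
    rw [← pow_mul]; simp; ring
  rw [legendre, iterate_derivative_C_mul, ← Function.iterate_add_apply, h,
    iterate_derivative_sum, Finset.mul_sum, gegenbauerForm]
  symm
  refine Finset.sum_subset_zero_on_sdiff ?_ ?_ ?_
  · intro i hi; simp only [Finset.mem_range] at *; omega
  -- For 2i > N the monomial has degree below N + 2m and is differentiated away.
  · intro i hi
    simp only [Finset.mem_sdiff, Finset.mem_range] at hi
    rw [iterate_derivative_C_mul, iterate_derivative_X_pow_eq_C_mul,
      Nat.descFactorial_eq_zero_iff_lt.mpr (by omega)]
    simp
  · intro i hi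
    rw [Finset.mem_range] at hi
    rw [iterate_derivative_C_mul, iterate_derivative_X_pow_eq_C_mul, ← mul_assoc, ← mul_assoc,
      ← C_mul, ← C_mul, one_pow, mul_one, smul_eq_C_mul,
      show 2 * (N + m - i) - (m + (N + m)) = N - 2 * i by omega]
    congr 2
    have h1 := Nat.factorial_mul_descFactorial (show m + (N + m) ≤ 2 * (N + m - i) by omega)
    rw [show 2 * (N + m - i) - (m + (N + m)) = N - 2 * i by omega] at h1
    rw [gegenbauerCoeff, ← h1]
    push_cast
    have h2 : ((N - 2 * i).factorial : ℝ) ≠ 0 := by positivity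
    field_simp

/-- Leibniz on (X - 1)^(N+m) (X + 1)^(N+m): at 1 only the term differentiating the first factor
exactly N + m times survives. -/
theorem gegenbauerForm_one_one (m N : ℕ) :
    gegenbauerForm m N (1 : ℝ) 1 =
      ((N + 2 * m).factorial : ℝ) / (2 ^ m * m.factorial * N.factorial) := by
  have h := congrArg (aeval (1 : ℝ)) (iterate_derivative_legendre m N)
  rw [map_gegenbauerForm, aeval_X, map_one] at h
  rw [← h, legendre, iterate_derivative_C_mul, ← Function.iterate_add_apply,
    show (X ^ 2 - 1 : ℝ[X]) = (X - C 1) * (X + C 1) by simp; ring, mul_pow,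
    iterate_derivative_mul, Finset.mul_sum, map_sum, Finset.sum_eq_single m]
  · rw [iterate_derivative_X_sub_pow, iterate_derivative_X_add_pow, Nat.add_sub_cancel_left,
      Nat.descFactorial_self]
    have h1 := Nat.factorial_mul_descFactorial (show m ≤ N + m by omega)
    have h2 := Nat.choose_mul_factorial_mul_factorial (show m ≤ m + (N + m) by omega)
    rw [Nat.add_sub_cancel_left] at h2
    rw [Nat.add_sub_cancel] at h1 ⊢
    rw [show N + 2 * m = m + (N + m) by ring, ← h2]
    have h3 : ((N + m).factorial : ℝ) = N.factorial * (N + m).descFactorial m := by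
      exact_mod_cast h1.symm
    have h4 : ((N + m).factorial : ℝ) ≠ 0 := by positivity
    simp
    field_simp
    rw [h3]
    norm_num [pow_add]
    ring
  · intro k hk hkm
    rw [iterate_derivative_X_sub_pow]
    rw [Finset.mem_range] at hk
    rcases lt_or_gt_of_ne hkm with hlt | hgt
    · rw [Nat.descFactorial_eq_zero_iff_lt.mpr (by omega)]
      simp
    · have : N + m - (m + (N + m) - k) ≠ 0 := by omega
      simp [this]
  · intro hm
    exact absurd (Finset.mem_range.mpr (by omega)) hm

/-! ### Uniqueness from the restriction to t = 1 -/

/-- Coefficientwise differentiation of polynomials with polynomial coefficients. -/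
noncomputable def coeffDerivation : Derivation ℝ ℝ[X][X] ℝ[X][X] :=
  ((PolynomialModule.equivPolynomialSelf (R := ℝ[X])).toLinearMap).compDer
    (derivative' (R := ℝ)).mapCoeffs

theorem coeff_coeffDerivation (p : ℝ[X][X]) (k : ℕ) :
    (coeffDerivation p).coeff k = derivative (p.coeff k) := rfl

/-- The outer variable is t - 1 and the inner one is z. As 1 - t² = -(t - 1)(t + 1), the equation at
order k expresses 2(k + 1)(k + m + 1) G_{k+1} through G_k and its z-derivatives, so G₀ = 0
propagates. -/
theorem eq_zero_of_gegenbauerOp_eq (m : ℕ) (G : ℝ[X][X])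
    (h : gegenbauerOp m (derivative'.restrictScalars ℝ) (X + 1) G =
      gegenbauerOp m coeffDerivation (C X) G) (h0 : G.coeff 0 = 0) : G = 0 := by
  have key : ∀ k, G.coeff k = 0 → (∀ j < k, G.coeff j = 0) → G.coeff (k + 1) = 0 := by
    intro k hk hj
    have h1 := congrArg (fun p => p.coeff k) h
    have hd : ∀ p : ℝ[X][X], (derivative'.restrictScalars ℝ : Derivation ℝ ℝ[X][X] ℝ[X][X]) p =
      derivative p := fun _ => rfl
    have c2 : (C 2 : ℝ[X][X]) = 2 := map_ofNat C 2
    simp only [gegenbauerOp_apply] at h1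
    have e1 : (1 - C X ^ 2 : ℝ[X][X]) = C (1 - X ^ 2) := by simp
    have e2 : (2 * ((m : ℝ[X][X]) + 1) * C X) = C (2 * ((m : ℝ[X]) + 1) * X) := by simp [c2]
    have e3 : (1 - (X + 1) ^ 2) * derivative (derivative G) -
        2 * ((m : ℝ[X][X]) + 1) * (X + 1) * derivative G =
        -(X * (X * derivative (derivative G))) - C 2 * (X * derivative (derivative G)) -
          C (2 * ((m : ℝ[X]) + 1)) * (X * derivative G) -
          C (2 * ((m : ℝ[X]) + 1)) * derivative G := by simp [c2]; ring
    rw [hd, hd, e1, e2, e3] at h1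
    simp only [coeff_sub, coeff_C_mul, coeff_coeffDerivation, hk, coeff_neg, derivative_zero] at h1
    have : (2 * ((k : ℝ[X]) + 1) * (k + m + 1)) * G.coeff (k + 1) = 0 := by
      rcases k with _ | _ | k
      · simp only [coeff_X_mul_zero, coeff_derivative] at h1
        push_cast at h1 ⊢
        linear_combination -h1
      · simp only [coeff_X_mul, coeff_X_mul_zero, coeff_derivative] at h1
        push_cast at h1 hk ⊢
        linear_combination -h1 - 2 * (m + 1) * hk
      · simp only [coeff_X_mul, coeff_derivative] at h1
        push_cast at h1 hk ⊢
        linear_combination -h1 - (k + 1 + 1) * (k + 1 + 2 * (m + 1)) * hk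
    refine (mul_eq_zero.mp this).resolve_left ?_
    have : (2 * ((k : ℝ[X]) + 1) * (k + m + 1)) = ((2 * (k + 1) * (k + m + 1) : ℕ) : ℝ[X]) := by
      push_cast; ring
    rw [this, ← ne_eq, Nat.cast_ne_zero]
    positivity
  have : ∀ k, ∀ j ≤ k, G.coeff j = 0 := by
    intro k
    induction k with
    | zero => intro j hj; rw [Nat.le_zero.mp hj, h0]
    | succ k ih =>
      intro j hj
      rcases Nat.lt_or_eq_of_le hj with hlt | rfl
      · exact ih j (by omega)
      · exact key k (ih k le_rfl) fun i hi => ih i hi.le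
  ext1 k
  rw [this k k le_rfl, coeff_zero]

/-! ### Pochhammer symbols and the product formula -/

theorem poch_succ (a : ℝ) (n : ℕ) : poch a (n + 1) = poch a n * (a + n) := by
  simp [poch, ascPochhammer_succ_eval]

theorem poch_zero (a : ℝ) : poch a 0 = 1 := by simp [poch]

theorem poch_pos {a : ℝ} (ha : 0 < a) (n : ℕ) : 0 < poch a n := ascPochhammer_pos n a ha

theorem poch_half (n : ℕ) : poch (1 / 2) n = (2 * n).factorial / (4 ^ n * n.factorial) := by
  induction n with
  | zero => simp [poch_zero]
  | succ n ih =>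
    rw [poch_succ, ih, show 2 * (n + 1) = 2 * n + 1 + 1 by ring]
    simp only [Nat.factorial_succ]
    push_cast
    have : (n.factorial : ℝ) ≠ 0 := by positivity
    field_simp
    ring

theorem poch_natCast_add_one (a k : ℕ) :
    poch ((a : ℝ) + 1) k = (a + k).factorial / a.factorial := by
  induction k with
  | zero => rw [poch_zero, add_zero, div_self (by positivity)]
  | succ k ih =>
    rw [poch_succ, ih, ← add_assoc, Nat.factorial_succ]
    push_cast
    ring

theorem coeffU_eq {n m k : ℕ} (hm : m ≤ n) (hk : 2 * k ≤ n) :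
    coeffU n m k = poch (1 / 2) (n - k) * (n + m).factorial /
      ((-4) ^ k * poch (1 / 2) n * k.factorial * (n + m - 2 * k).factorial) := by
  have h : (n : ℝ) + m - 2 * k + 1 = ((n + m - 2 * k : ℕ) : ℝ) + 1 := by
    rw [Nat.cast_sub (by omega)]; push_cast; ring
  rw [coeffU, if_pos ⟨hm, hk⟩, h, poch_natCast_add_one, Nat.sub_add_cancel (by omega)]
  field_simp

/-- The coefficient of z^(N-2k) in the product formula at t = 1; this is what fixes u_{n,m,k}. -/
theorem gegenbauerForm_coeff_identity (m N k : ℕ) (hk : 2 * k ≤ N) :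
    N.factorial / (2 ^ (N + m) * poch (1 / 2) (N + m)) *
      gegenbauerForm m N (1 : ℝ) 1 * gegenbauerCoeff m N k =
    coeffU (N + m) m k * gegenbauerForm m (N - 2 * k) (1 : ℝ) 1 := by
  have hc : ((N + m).factorial : ℝ) =
      (N + m).choose k * k.factorial * (N + m - k).factorial := by
    exact_mod_cast (Nat.choose_mul_factorial_mul_factorial (show k ≤ N + m by omega)).symm
  rw [coeffU_eq (by omega) (by omega), gegenbauerForm_one_one, gegenbauerForm_one_one,
    gegenbauerCoeff, poch_half (N + m - k), hc, show N + m + m = N + 2 * m by ring,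
    show N - 2 * k + 2 * m = N + 2 * m - 2 * k by omega]
  have h0 : (0 : ℝ) < poch (1 / 2) (N + m) := poch_pos (by norm_num) _
  have h1 : (0 : ℝ) < (N + m).choose k := by
    exact_mod_cast Nat.choose_pos (show k ≤ N + m by omega)
  have h4 : (2 : ℝ) ^ (N + m) * 2 ^ (N + m) = 4 ^ (N + m - k) * 4 ^ k := by
    rw [← mul_pow, ← pow_add, Nat.sub_add_cancel (by omega)]; norm_num
  have h5 : (-4 : ℝ) ^ k = (-1) ^ k * 4 ^ k := by rw [← mul_pow]; norm_num
  have h6 : ((-1 : ℝ) ^ k) ^ 2 = 1 := by rw [← pow_mul, mul_comm, pow_mul]; simp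
  have h7 : (-1 : ℝ) ^ k ≠ 0 := by simp
  rw [h5]
  have : (N.factorial : ℝ) ≠ 0 := by positivity
  have : (k.factorial : ℝ) ≠ 0 := by positivity
  have : (m.factorial : ℝ) ≠ 0 := by positivity
  have : ((N + m - k).factorial : ℝ) ≠ 0 := by positivity
  have : ((N + 2 * m - 2 * k).factorial : ℝ) ≠ 0 := by positivity
  have : ((N - 2 * k).factorial : ℝ) ≠ 0 := by positivity
  field_simp
  linear_combination (4 : ℝ) ^ (N + m - k) * 4 ^ k * h6 - h4

theorem gegenbauerForm_product_polynomial (m N : ℕ) :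
    (N.factorial / (2 ^ (N + m) * poch (1 / 2) (N + m)) : ℝ) •
      (gegenbauerForm m N (X + 1 : ℝ[X][X]) 1 * gegenbauerForm m N (C X : ℝ[X][X]) 1) =
    ∑ k ∈ Finset.range (N / 2 + 1), coeffU (N + m) m k •
      gegenbauerForm m (N - 2 * k) ((X + 1) * C X : ℝ[X][X]) ((X + 1) ^ 2 + C X ^ 2 - 1) := by
  have dt : (derivative'.restrictScalars ℝ : Derivation ℝ ℝ[X][X] ℝ[X][X]) (X + 1) = 1 := by
    change derivative (X + 1 : ℝ[X][X]) = 1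
    simp
  have dz : (derivative'.restrictScalars ℝ : Derivation ℝ ℝ[X][X] ℝ[X][X]) (C X) = 0 := by
    change derivative (C X : ℝ[X][X]) = 0
    simp
  have et : coeffDerivation (X + 1) = 0 := by
    ext1 k
    rw [coeff_coeffDerivation, coeff_add, coeff_X, coeff_one]
    split_ifs <;> simp
  have ez : coeffDerivation (C X) = 1 := by
    ext1 k
    rw [coeff_coeffDerivation, coeff_C, coeff_one]
    split_ifs <;> simp_all
  rw [← sub_eq_zero]
  refine eq_zero_of_gegenbauerOp_eq m _ ?_ ?_
  · simp only [map_sub, map_smul, map_sum, gegenbauerOp_sub_form m _ _ _ _ _ dt dz et ez,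
      gegenbauerOp_form_mul_form m _ _ _ _ _ dt dz et ez]
  -- The homomorphism φ restricts to t = 1, keeping z as the variable.
  · let φ : ℝ[X][X] →ₐ[ℝ] ℝ[X] := (aeval (0 : ℝ[X])).restrictScalars ℝ
    have hφ : ∀ p : ℝ[X][X], p.coeff 0 = φ p := coeff_zero_eq_aeval_zero
    have hX : φ X = 0 := aeval_X _
    have hC : φ (C X) = X := aeval_C _ _
    rw [hφ]
    simp only [map_sub, map_smul, map_sum, map_mul, map_gegenbauerForm, map_add, map_pow, map_one,
      hX, hC, zero_add, one_mul, one_pow, add_sub_cancel_left]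
    have h1 : ∀ M, gegenbauerForm m M (1 : ℝ[X]) 1 = C (gegenbauerForm m M (1 : ℝ) 1) := by
      intro M
      have := map_gegenbauerForm (Algebra.ofId ℝ ℝ[X]) m M 1 1
      simpa using this.symm
    have h2 : ∀ M, gegenbauerForm m M (X : ℝ[X]) (X ^ 2) =
        C (gegenbauerForm m M (1 : ℝ) 1) * X ^ M := by
      intro M
      have := gegenbauerForm_mul m M (X : ℝ[X]) 1 1
      rw [mul_one, mul_one] at this
      rw [this, h1, mul_comm]
    simp only [h1, h2]
    rw [sub_eq_zero, gegenbauerForm.eq_1 m N (X : ℝ[X]), Finset.mul_sum, Finset.smul_sum]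
    refine Finset.sum_congr rfl fun k hk => ?_
    have hk' : 2 * k ≤ N := by have := Finset.mem_range.mp hk; omega
    simp only [smul_eq_C_mul, one_pow, mul_one, ← mul_assoc, ← C_mul]
    rw [gegenbauerForm_coeff_identity m N k hk']

theorem gegenbauerForm_product {B : Type*} [CommRing B] [Algebra ℝ B] (m N : ℕ) (t z : B) :
    (N.factorial / (2 ^ (N + m) * poch (1 / 2) (N + m)) : ℝ) •
      (gegenbauerForm m N t 1 * gegenbauerForm m N z 1) =
    ∑ k ∈ Finset.range (N / 2 + 1), coeffU (N + m) m k •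
      gegenbauerForm m (N - 2 * k) (t * z) (t ^ 2 + z ^ 2 - 1) := by
  obtain ⟨ψ, hX, hC⟩ : ∃ ψ : ℝ[X][X] →ₐ[ℝ] B, ψ X = t - 1 ∧ ψ (C X) = z :=
    ⟨aevalAeval z (t - 1), aevalAeval_Y _ _, aevalAeval_X _ _⟩
  have h := congrArg ψ (gegenbauerForm_product_polynomial m N)
  simpa only [map_sub, map_smul, map_sum, map_mul, map_gegenbauerForm, map_add, map_pow, map_one,
    hX, hC, sub_add_cancel] using h

/-! ### Harmonics in Cartesian coordinates -/

theorem norm_sq_eq (x : E3) : ‖x‖ ^ 2 = x 0 ^ 2 + axialDist x ^ 2 := by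
  rw [EuclideanSpace.real_norm_sq_eq, Fin.sum_univ_three, axialDist, Real.sq_sqrt (by positivity)]
  ring

theorem axialDist_nonneg (x : E3) : 0 ≤ axialDist x := Real.sqrt_nonneg _

theorem eval_iterate_derivative_legendre (m N : ℕ) (t : ℝ) :
    (derivative^[m] (legendre (N + m))).eval t = gegenbauerForm m N t 1 := by
  have := map_gegenbauerForm (aeval t : ℝ[X] →ₐ[ℝ] ℝ) m N X 1
  rwa [aeval_X, map_one, ← iterate_derivative_legendre, coe_aeval_eq_eval] at this

theorem aeval_iterate_derivative_legendre (m N : ℕ) (z : ℂ) :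
    aeval z (derivative^[m] (legendre (N + m))) = gegenbauerForm m N z 1 := by
  rw [iterate_derivative_legendre, map_gegenbauerForm, aeval_X, map_one]

theorem ofReal_gegenbauerForm (m N : ℕ) (a b : ℝ) :
    ((gegenbauerForm m N a b : ℝ) : ℂ) = gegenbauerForm m N (a : ℂ) (b : ℂ) :=
  map_gegenbauerForm (Algebra.ofId ℝ ℂ) m N a b

theorem norm_mul_sqrt (x : E3) : ‖x‖ * √(1 - (x 0 / ‖x‖) ^ 2) = axialDist x := by
  have h := norm_sq_eq x
  have hρ := axialDist_nonneg x
  rcases eq_or_ne ‖x‖ 0 with h0 | h0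
  · rw [h0] at h ⊢
    have : axialDist x ^ 2 = 0 := by nlinarith [sq_nonneg (x 0), sq_nonneg (axialDist x)]
    simpa using (pow_eq_zero_iff two_ne_zero).mp this |>.symm
  · have h1 : 0 < ‖x‖ := lt_of_le_of_ne (norm_nonneg x) h0.symm
    rw [show 1 - (x 0 / ‖x‖) ^ 2 = (axialDist x / ‖x‖) ^ 2 by field_simp; linarith,
      Real.sqrt_sq (by positivity)]
    field_simp

theorem solidHarmonic_zero (s : Parity) (N m : ℕ) (x : E3) :
    solidHarmonic 0 s (N + m) m x = (-1) ^ m * (axialDist x ^ m * angular s m (azimuth x)) *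
      gegenbauerForm m N (x 0) (‖x‖ ^ 2) := by
  -- At the origin both sides vanish, so the default value of division by zero does no harm.
  have h0 : ‖x‖ * (x 0 / ‖x‖) = x 0 := by
    rcases eq_or_ne x 0 with rfl | h
    · simp
    · have : ‖x‖ ≠ 0 := norm_ne_zero_iff.mpr h
      field_simp
  have h := gegenbauerForm_mul m N ‖x‖ (x 0 / ‖x‖) 1
  rw [h0, mul_one] at h
  rw [solidHarmonic, if_pos rfl, legendreOnCut, eval_iterate_derivative_legendre, h,
    ← norm_mul_sqrt, mul_pow, pow_add]
  ring

/-- The right side involves only x and μ, so the arbitrary choice of coordinates in `solidHarmonic`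
is immaterial. -/
theorem harmonicFactor_eq {μ : ℂ} {x : E3} {u : ℝ} {v : ℂ} (h : IsSpheroidalCoords μ x u v)
    (N m : ℕ) :
    harmonicFactor μ (N + m) m u v = ∑ k ∈ Finset.range (N / 2 + 1),
      ((coeffU (N + m) m k * ((-1) ^ m * axialDist x ^ m *
        gegenbauerForm m (N - 2 * k) (x 0) (‖x‖ ^ 2)) : ℝ) : ℂ) * μ ^ (2 * k) := by
  obtain ⟨hu0, hupi, -, -, hx, hρ⟩ := h
  have hsin : √(1 - Real.cos u ^ 2) = Real.sin u := by
    rw [← Real.sin_sq, Real.sqrt_sq (Real.sin_nonneg_of_nonneg_of_le_pi hu0 hupi)]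
  have hr : ((‖x‖ ^ 2 : ℝ) : ℂ) = μ ^ 2 * ((Real.cos u : ℂ) ^ 2 + Complex.cosh v ^ 2 - 1) := by
    rw [norm_sq_eq]
    push_cast at hx hρ ⊢
    rw [hx, hρ]
    linear_combination μ ^ 2 * Complex.sinh v ^ 2 * Complex.sin_sq_add_cos_sq (u : ℂ) +
      μ ^ 2 * (Complex.cos u ^ 2 - 1) * Complex.cosh_sq v
  have key := gegenbauerForm_product m N (Real.cos u : ℂ) (Complex.cosh v)
  rw [harmonicFactor, legendreOnCut, legendreAtCosh, Nat.add_sub_cancel, hsin,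
    eval_iterate_derivative_legendre, aeval_iterate_derivative_legendre]
  push_cast [ofReal_gegenbauerForm] at key ⊢
  have h1 : ∀ k ∈ Finset.range (N / 2 + 1),
      (coeffU (N + m) m k : ℂ) * ((-1) ^ m * (axialDist x : ℂ) ^ m *
        gegenbauerForm m (N - 2 * k) (x 0 : ℂ) ((‖x‖ : ℂ) ^ 2)) * μ ^ (2 * k) =
      ((-1) ^ m * (axialDist x : ℂ) ^ m * μ ^ N) * (coeffU (N + m) m k •
        gegenbauerForm m (N - 2 * k) (Complex.cos u * Complex.cosh v)
          (Complex.cos u ^ 2 + Complex.cosh v ^ 2 - 1)) := by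
    intro k hk
    have hk' : N = N - 2 * k + 2 * k := by have := Finset.mem_range.mp hk; omega
    push_cast at hr hx
    rw [hr, hx, mul_assoc μ, gegenbauerForm_mul]
    -- Homogeneity of the form absorbs μ^(N-2k); the other μ^m sits in axialDist^m.
    have hp : μ ^ N = μ ^ (N - 2 * k) * μ ^ (2 * k) := by rw [← pow_add, ← hk']
    rw [hp, Complex.real_smul]
    ring
  rw [Finset.sum_congr rfl h1, ← Finset.mul_sum, ← key, hρ, Complex.real_smul]
  push_cast
  ring

theorem exists_sq_eq_ofReal {μ : ℂ} (hμ : μ ∈ params) : ∃ c : ℝ, μ ^ 2 = c := by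
  rcases hμ with ⟨r, -, -, rfl⟩ | ⟨r, -, rfl⟩
  · exact ⟨r ^ 2, by push_cast; rfl⟩
  · exact ⟨-r ^ 2, by rw [mul_pow, Complex.I_sq]; push_cast; ring⟩

theorem coeffU_zero {n m : ℕ} (hm : m ≤ n) : coeffU n m 0 = 1 := by
  rw [coeffU_eq hm (by omega)]
  have h : poch (1 / 2) n ≠ 0 := (poch_pos (by norm_num) n).ne'
  have h' : ((n + m).factorial : ℝ) ≠ 0 := by positivity
  rw [pow_zero, one_mul, mul_zero, Nat.factorial_zero, Nat.cast_one, mul_one, Nat.sub_zero,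
    Nat.sub_zero, div_self (mul_ne_zero h h')]

theorem solidHarmonic_eq_sum_zero {μ : ℂ} (hμ : μ ∈ params) (s : Parity) {n m : ℕ} (hm : m ≤ n)
    (x : E3) :
    solidHarmonic μ s n m x = ∑ k ∈ Finset.range ((n - m) / 2 + 1),
      (coeffU n m k * (μ ^ (2 * k)).re) * solidHarmonic 0 s (n - 2 * k) m x := by
  rcases eq_or_ne μ 0 with rfl | h0
  · rw [Finset.sum_range_succ', Finset.sum_eq_zero]
    · simp [coeffU_zero hm]
    · intro k _
      simp
  · obtain ⟨N, rfl⟩ := Nat.exists_eq_add_of_le' hm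
    have hex := exists_spheroidalCoords hμ h0 x
    rw [solidHarmonic, if_neg h0, dif_pos hex, harmonicFactor_eq hex.choose_spec, Complex.re_sum,
      Finset.sum_mul, Nat.add_sub_cancel]
    refine Finset.sum_congr rfl fun k hk => ?_
    have hk' : N + m - 2 * k = (N - 2 * k) + m := by have := Finset.mem_range.mp hk; omega
    rw [hk', solidHarmonic_zero, Complex.re_ofReal_mul]
    ring

/-! ### Differentiability and linearity of ∂̄ -/

/-- De Moivre; the polynomial on the right gives smoothness across the axis, where the azimuth is
singular. -/
theorem axialDist_pow_mul_angular (s : Parity) (m : ℕ) (x : E3) :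
    axialDist x ^ m * angular s m (azimuth x) =
      match s with
      | Parity.plus => (((x 1 : ℂ) + x 2 * Complex.I) ^ m).re
      | Parity.minus => (((x 1 : ℂ) + x 2 * Complex.I) ^ m).im := by
  have h : ((x 1 : ℂ) + x 2 * Complex.I) ^ m = (axialDist x ^ m : ℝ) *
      (Complex.cos (m * azimuth x : ℝ) + Complex.sin (m * azimuth x : ℝ) * Complex.I) := by
    have h1 := Complex.norm_mul_exp_arg_mul_I ⟨x 1, x 2⟩
    have h2 : ‖(⟨x 1, x 2⟩ : ℂ)‖ = axialDist x := by
      rw [Complex.norm_def, Complex.normSq_mk, axialDist]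
      ring_nf
    rw [h2, ← azimuth, Complex.mk_eq_add_mul_I] at h1
    rw [← h1, mul_pow, ← Complex.exp_nat_mul, ← Complex.exp_mul_I]
    push_cast
    ring_nf
  rw [h]
  generalize axialDist x ^ m = r
  rcases s <;> simp [angular, ← Complex.ofReal_cos, ← Complex.ofReal_sin, -Complex.ofReal_mul]

theorem differentiable_solidHarmonic_zero (s : Parity) {n m : ℕ} (hm : m ≤ n) :
    Differentiable ℝ (solidHarmonic 0 s n m) := by
  obtain ⟨N, rfl⟩ := Nat.exists_eq_add_of_le' hm
  have hx : ∀ i : Fin 3, Differentiable ℝ fun x : E3 => x i := fun i => by fun_prop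
  have hz : Differentiable ℝ fun x : E3 => ((x 1 : ℂ) + x 2 * Complex.I) ^ m :=
    ((Complex.ofRealCLM.differentiable.comp (hx 1)).add
      ((Complex.ofRealCLM.differentiable.comp (hx 2)).mul_const _)).pow m
  have h1 : Differentiable ℝ fun x : E3 => axialDist x ^ m * angular s m (azimuth x) := by
    simp only [axialDist_pow_mul_angular]
    rcases s
    · exact Complex.reCLM.differentiable.comp hz
    · exact Complex.imCLM.differentiable.comp hz
  have h2 : Differentiable ℝ fun x : E3 => gegenbauerForm m N (x 0) (‖x‖ ^ 2) := by
    simp only [gegenbauerForm, smul_eq_mul]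
    refine Differentiable.fun_sum fun k _ => ?_
    exact (((hx 0).pow _).mul ((differentiable_id.norm_sq ℝ).pow _)).const_mul _
  rw [show solidHarmonic 0 s (N + m) m = _ from funext (solidHarmonic_zero s N m)]
  exact (h1.const_mul _).mul h2

theorem differentiable_solidHarmonic {μ : ℂ} (hμ : μ ∈ params) (s : Parity) {n m : ℕ}
    (hm : m ≤ n) : Differentiable ℝ (solidHarmonic μ s n m) := by
  rw [show solidHarmonic μ s n m = _ from funext (solidHarmonic_eq_sum_zero hμ s hm)]
  refine Differentiable.fun_sum fun k hk => ?_
  have := Finset.mem_range.mp hk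
  exact (differentiable_solidHarmonic_zero s (by omega)).const_mul _

theorem conjDirac_sum {ι : Type*} (t : Finset ι) (c : ι → ℝ) (f : ι → E3 → ℝ)
    (hf : ∀ i ∈ t, Differentiable ℝ (f i)) (x : E3) :
    conjDirac (fun y => ∑ i ∈ t, c i * f i y) x = ∑ i ∈ t, c i • conjDirac (f i) x := by
  have h : ∀ j, partialDeriv j (fun y => ∑ i ∈ t, c i * f i y) x =
      ∑ i ∈ t, c i * partialDeriv j (f i) x := by
    intro j
    have h1 : HasLineDerivAt ℝ (fun y => ∑ i ∈ t, c i * f i y)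
        (∑ i ∈ t, c i * partialDeriv j (f i) x) x (EuclideanSpace.single j 1) := by
      refine HasDerivAt.fun_sum fun i hi => ?_
      exact ((hf i hi x).lineDifferentiableAt.hasLineDerivAt).const_mul (c i)
    exact h1.lineDeriv
  rw [conjDirac, h, h, h]
  clear h hf
  classical
  induction t using Finset.induction_on with
  | empty => simp; rfl
  | insert i t hi ih =>
    rw [Finset.sum_insert (f := fun i => c i • conjDirac (f i) x) hi, ← ih]
    refine QuaternionAlgebra.ext (Finset.sum_insert hi) ?_ ?_ ?_
    · change -_ = c i * -partialDeriv 1 (f i) x + -_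
      rw [Finset.sum_insert hi]
      ring
    · change -_ = c i * -partialDeriv 2 (f i) x + -_
      rw [Finset.sum_insert hi]
      ring
    · change 0 = c i * 0 + 0
      ring

/-! ### Inverse and conversion coefficients -/

/-- The factor 2n - 4k + 1 raises (1/2)_{n-2k} to index n - 2k + 1, and (2n - 2k + 1)!/(n - k)! is a
power of 2 times (1/2)_{n+1-k}. -/
theorem coeffUInv_eq {n m k : ℕ} (hk : 2 * k ≤ n) :
    coeffUInv n m k = (n + m).factorial * poch (1 / 2) (n + 1 - 2 * k) /
      (4 ^ k * k.factorial * (n + m - 2 * k).factorial * poch (1 / 2) (n + 1 - k)) := by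
  obtain ⟨l, rfl⟩ := Nat.exists_eq_add_of_le hk
  have e1 : 2 * k + l + 1 - 2 * k = l + 1 := by omega
  have e2 : 2 * k + l + 1 - k = k + l + 1 := by omega
  have e3 : 2 * (2 * k + l) - 2 * k + 1 = 2 * (k + l) + 1 := by omega
  have e4 : 2 * k + l - k = k + l := by omega
  have e5 : 2 * k + l - 2 * k = l := by omega
  rw [coeffUInv, e1, e2, e3, e4, e5, poch_succ _ l, poch_half (k + l + 1), add_comm m,
    show 2 * (k + l + 1) = 2 * (k + l) + 1 + 1 by ring]
  simp only [Nat.factorial_succ]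
  push_cast
  have : ((2 * k + l + m - 2 * k).factorial : ℝ) ≠ 0 := by positivity
  have : ((k + l).factorial : ℝ) ≠ 0 := by positivity
  have : ((2 * (k + l)).factorial : ℝ) ≠ 0 := by positivity
  have : (k.factorial : ℝ) ≠ 0 := by positivity
  have h : (2 * ((k : ℝ) + l) + 1 + 1) = 2 * (k + l + 1) := by ring
  have h' : (k : ℝ) + l + 1 ≠ 0 := by positivity
  have h'' : 2 * ((k : ℝ) + l) + 1 ≠ 0 := by positivity
  rw [h]
  field_simp
  ring

/-- A closed form for every partial sum makes induction possible; at j = k + 1 the factor `k.choose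
(k + 1)` makes the full sum zero. -/
theorem sum_poch_telescope {n k : ℕ} (hk : 2 * (k + 1) ≤ n) (j : ℕ) (hj : j ≤ k + 1) :
    ∑ i ∈ Finset.range (j + 1), (-1 : ℝ) ^ i * (k + 1).choose i * ((n : ℝ) - 2 * i + 1 / 2) *
        poch (1 / 2) (n - i - (k + 1)) / poch (1 / 2) (n + 1 - i) =
      (-1) ^ j * k.choose j * poch (1 / 2) (n - j - (k + 1)) / poch (1 / 2) (n - j) := by
  have hp : ∀ a, poch (1 / 2) a ≠ 0 := fun a => (poch_pos (by norm_num) a).ne'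
  induction j with
  | zero =>
    have h1 : (n : ℝ) + 1 / 2 ≠ 0 := by positivity
    have h2 := hp n
    simp only [zero_add, Finset.sum_range_one, Nat.sub_zero, poch_succ]
    rw [add_comm (1 / 2 : ℝ)]
    simp
    field_simp
  | succ j ih =>
    rw [Finset.sum_range_succ, ih (by omega)]
    obtain ⟨M, hM⟩ : ∃ M, n = M + (k + 1) + (j + 1) := ⟨n - (k + 1) - (j + 1), by omega⟩
    rw [show n - j - (k + 1) = M + 1 by omega, show n - j = M + (k + 1) + 1 by omega,
      show n - (j + 1) - (k + 1) = M by omega, show n + 1 - (j + 1) = M + (k + 1) + 1 by omega,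
      show n - (j + 1) = M + (k + 1) by omega, poch_succ _ M, poch_succ _ (M + (k + 1)), hM,
      Nat.choose_succ_succ]
    have hc : (k.choose (j + 1) : ℝ) * (j + 1) = k.choose j * (k - j) := by
      have := Nat.choose_succ_right_eq k j
      have h2 : ((k - j : ℕ) : ℝ) = k - j := Nat.cast_sub (by omega)
      rw [← h2]
      exact_mod_cast this
    have h1 : 1 / 2 + ((M + (k + 1) : ℕ) : ℝ) ≠ 0 := by positivity
    have h2 := hp (M + (k + 1))
    rw [pow_succ]
    push_cast at h1 ⊢
    field_simp
    linear_combination 2 * poch (1 / 2) M * hc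

theorem sum_coeffUInv_mul_coeffU {n m k : ℕ} (hk0 : 0 < k) (hk : 2 * k ≤ n - m) (hm : m ≤ n) :
    ∑ i ∈ Finset.range (k + 1), coeffUInv n m i * coeffU (n - 2 * i) m (k - i) = 0 := by
  have hp : ∀ a, poch (1 / 2) a ≠ 0 := fun a => (poch_pos (by norm_num) a).ne'
  obtain ⟨l, rfl⟩ : ∃ l, k = l + 1 := ⟨k - 1, by omega⟩
  have h := sum_poch_telescope (n := n) (k := l) (by omega) (l + 1) le_rfl
  rw [Nat.choose_succ_self, Nat.cast_zero, mul_zero, zero_mul, zero_div] at h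
  rw [← mul_zero (((n + m).factorial : ℝ) /
    ((-4) ^ (l + 1) * (l + 1).factorial * (n + m - 2 * (l + 1)).factorial)), ← h, Finset.mul_sum]
  refine Finset.sum_congr rfl fun i hi => ?_
  have hi' : i ≤ l + 1 := by have := Finset.mem_range.mp hi; omega
  rw [coeffUInv_eq (by omega), coeffU_eq (by omega) (by omega),
    show n - 2 * i - (l + 1 - i) = n - i - (l + 1) by omega,
    show n - 2 * i + m = n + m - 2 * i by omega,
    show n + m - 2 * i - 2 * (l + 1 - i) = n + m - 2 * (l + 1) by omega,
    show n + 1 - 2 * i = n - 2 * i + 1 by omega, poch_succ _ (n - 2 * i),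
    Nat.cast_sub (by omega : 2 * i ≤ n)]
  have hc : ((l + 1).factorial : ℝ) = (l + 1).choose i * i.factorial * (l + 1 - i).factorial := by
    exact_mod_cast (Nat.choose_mul_factorial_mul_factorial hi').symm
  have hc0 : ((l + 1).choose i : ℝ) ≠ 0 := by exact_mod_cast (Nat.choose_pos hi').ne'
  have h4 : (-4 : ℝ) ^ (l + 1) = (-4) ^ (l + 1 - i) * ((-1) ^ i * 4 ^ i) := by
    rw [← mul_pow, show (-1 * 4 : ℝ) = -4 by norm_num, ← pow_add, Nat.sub_add_cancel hi']
  have h5 : ((-1 : ℝ) ^ i) ^ 2 = 1 := by rw [← pow_mul, mul_comm, pow_mul]; simp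
  rw [hc, h4]
  have := hp (n + 1 - i)
  have := hp (n - 2 * i)
  have : (i.factorial : ℝ) ≠ 0 := by positivity
  have : ((l + 1 - i).factorial : ℝ) ≠ 0 := by positivity
  have : ((n + m - 2 * i).factorial : ℝ) ≠ 0 := by positivity
  have : ((n + m - 2 * (l + 1)).factorial : ℝ) ≠ 0 := by positivity
  have : (-1 : ℝ) ^ i ≠ 0 := by simp
  have : (-4 : ℝ) ^ (l + 1 - i) ≠ 0 := by simp
  push_cast
  field_simp
  ring

theorem poch_neg_natCast {k j : ℕ} (hj : j ≤ k) :
    poch (-(k : ℝ)) j = (-1) ^ j * k.factorial / (k - j).factorial := by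
  induction j with
  | zero => rw [poch_zero, pow_zero, one_mul, Nat.sub_zero, div_self (by positivity)]
  | succ j ih =>
    obtain ⟨l, hl⟩ : ∃ l, k = l + j + 1 := ⟨k - j - 1, by omega⟩
    rw [poch_succ, ih (by omega), show k - j = l + 1 by omega, show k - (j + 1) = l by omega,
      Nat.factorial_succ l, show (k : ℝ) = l + j + 1 by rw [hl]; push_cast; ring]
    have : (l.factorial : ℝ) ≠ 0 := by positivity
    push_cast
    field_simp
    ring

/-- Reversal of the product; both lower-order parameters of the ₂F₁ have the form 1/2 - integer. -/
theorem poch_half_sub {n j : ℕ} (hj : j ≤ n) :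
    poch (1 / 2 - n) j = (-1) ^ j * poch (1 / 2) n / poch (1 / 2) (n - j) := by
  have hp : ∀ a, poch (1 / 2) a ≠ 0 := fun a => (poch_pos (by norm_num) a).ne'
  induction j with
  | zero => rw [poch_zero, pow_zero, one_mul, Nat.sub_zero, div_self (hp n)]
  | succ j ih =>
    obtain ⟨l, hl⟩ : ∃ l, n = l + j + 1 := ⟨n - j - 1, by omega⟩
    rw [poch_succ, ih (by omega), show n - j = l + 1 by omega, show n - (j + 1) = l by omega,
      poch_succ _ l, show (1 / 2 - (n : ℝ) + j) = -(1 / 2 + l) by rw [hl]; push_cast; ring]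
    have : (1 / 2 + (l : ℝ)) ≠ 0 := by positivity
    have := hp l
    field_simp
    ring

theorem ordinaryHypergeometric_neg_natCast (k : ℕ) (b c y : ℝ) :
    ordinaryHypergeometric (-(k : ℝ)) b c y = ∑ j ∈ Finset.range (k + 1),
      ((j.factorial : ℝ)⁻¹ * poch (-(k : ℝ)) j * poch b j * (poch c j)⁻¹) * y ^ j := by
  rw [ordinaryHypergeometric_eq_tsum]
  refine tsum_eq_sum fun j hj => ?_
  have hj' : k < j := by rw [Finset.mem_range] at hj; omega
  rw [(ascPochhammer_eval_eq_zero_iff j (-(k : ℝ))).mpr ⟨k, hj', by simp⟩]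
  simp

/-- Term by term, the convolution of the two families is the hypergeometric polynomial times w. -/
theorem coeffU_mul_coeffUInv {n m k j : ℕ} (hm : m ≤ n + 1) (hk : 2 * k ≤ n + 1 - m)
    (hj : j ≤ k) :
    coeffU (n + 1) m j * coeffUInv (n + 1 - 2 * j) m (k - j) =
      ((j.factorial : ℝ)⁻¹ * poch (-(k : ℝ)) j * poch (-(n : ℝ) + k - 3 / 2) j *
        (poch (-(n : ℝ) - 1 / 2) j)⁻¹) * coeffW n m k := by
  have hp : ∀ a, poch (1 / 2) a ≠ 0 := fun a => (poch_pos (by norm_num) a).ne'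
  have e1 : -(n : ℝ) + k - 3 / 2 = 1 / 2 - (n + 2 - k : ℕ) := by
    rw [Nat.cast_sub (by omega)]; push_cast; ring
  have e2 : -(n : ℝ) - 1 / 2 = 1 / 2 - (n + 1 : ℕ) := by push_cast; ring
  rw [e1, e2, poch_half_sub (by omega), poch_half_sub (by omega), poch_neg_natCast hj,
    coeffU_eq hm (by omega), coeffUInv_eq (by omega), coeffW,
    show n + 1 - 2 * j + m - 2 * (k - j) = n + m + 1 - 2 * k by omega,
    show n + 1 - 2 * j + m = n + 1 + m - 2 * j by omega,
    show n + 1 - 2 * j + 1 - 2 * (k - j) = n + 2 - 2 * k by omega,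
    show n + 1 - 2 * j + 1 - (k - j) = n + 2 - k - j by omega,
    show n + m + 1 = n + 1 + m by omega]
  have h4 : (4 : ℝ) ^ k = 4 ^ (k - j) * 4 ^ j := by rw [← pow_add, Nat.sub_add_cancel hj]
  have h5 : (-4 : ℝ) ^ j = (-1) ^ j * 4 ^ j := by rw [← mul_pow]; norm_num
  have h6 : ((-1 : ℝ) ^ j) ^ 2 = 1 := by rw [← pow_mul, mul_comm, pow_mul]; simp
  have : (-1 : ℝ) ^ j ≠ 0 := by simp
  have := hp (n + 1)
  have := hp (n + 1 - j)
  have := hp (n + 2 - k)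
  have := hp (n + 2 - k - j)
  have : (j.factorial : ℝ) ≠ 0 := by positivity
  have : (k.factorial : ℝ) ≠ 0 := by positivity
  have : ((k - j).factorial : ℝ) ≠ 0 := by positivity
  have : ((n + 1 + m - 2 * j).factorial : ℝ) ≠ 0 := by positivity
  have : ((n + 1 + m - 2 * k).factorial : ℝ) ≠ 0 := by positivity
  rw [h4, h5]
  field_simp
  linear_combination -poch (1 / 2) (n + 2 - 2 * k) * h6

/-! ### Expansions of the harmonics and of the monogenics -/

theorem re_pow_two_mul {μ : ℂ} {c : ℝ} (h : μ ^ 2 = c) (k : ℕ) : (μ ^ (2 * k)).re = c ^ k := by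
  rw [pow_mul, h, ← Complex.ofReal_pow, Complex.ofReal_re]

theorem coeffUInv_zero {n m : ℕ} : coeffUInv n m 0 = 1 := by
  have h : poch (1 / 2) (n + 1) ≠ 0 := (poch_pos (by norm_num) _).ne'
  have h' : ((n + m).factorial : ℝ) ≠ 0 := by positivity
  rw [coeffUInv_eq (by omega), pow_zero, mul_zero, Nat.factorial_zero, Nat.cast_one, one_mul,
    one_mul, Nat.sub_zero, Nat.sub_zero, div_self (mul_ne_zero h' h)]

/-- Expanding each U[μ] on the right in spherical harmonics and grouping by k = i + j leaves only k
= 0. -/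
theorem solidHarmonic_zero_eq_sum {μ : ℂ} (hμ : μ ∈ params) (s : Parity) {n m : ℕ} (hm : m ≤ n)
    (x : E3) :
    solidHarmonic 0 s n m x = ∑ k ∈ Finset.range ((n - m) / 2 + 1),
      (coeffUInv n m k * (μ ^ (2 * k)).re) * solidHarmonic μ s (n - 2 * k) m x := by
  obtain ⟨c, hc⟩ := exists_sq_eq_ofReal hμ
  have h1 : ∀ i ∈ Finset.range ((n - m) / 2 + 1),
      (coeffUInv n m i * (μ ^ (2 * i)).re) * solidHarmonic μ s (n - 2 * i) m x =
      ∑ j ∈ Finset.range ((n - m) / 2 + 1 - i), coeffUInv n m i * coeffU (n - 2 * i) m j *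
        (c ^ (i + j) * solidHarmonic 0 s (n - 2 * (i + j)) m x) := by
    intro i hi
    rw [Finset.mem_range] at hi
    rw [solidHarmonic_eq_sum_zero hμ s (by omega), Finset.mul_sum,
      show (n - 2 * i - m) / 2 + 1 = (n - m) / 2 + 1 - i by omega]
    refine Finset.sum_congr rfl fun j _ => ?_
    rw [re_pow_two_mul hc, re_pow_two_mul hc, pow_add,
      show n - 2 * i - 2 * j = n - 2 * (i + j) by omega]
    ring
  rw [Finset.sum_congr rfl h1, ← Finset.sum_range_diag_flip _ fun i j =>
    coeffUInv n m i * coeffU (n - 2 * i) m j *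
      (c ^ (i + j) * solidHarmonic 0 s (n - 2 * (i + j)) m x), Finset.sum_range_succ',
    Finset.sum_eq_zero]
  · simp [coeffUInv_zero, coeffU_zero hm]
  · intro k hk
    rw [Finset.mem_range] at hk
    rw [← zero_mul (c ^ (k + 1) * solidHarmonic 0 s (n - 2 * (k + 1)) m x),
      ← sum_coeffUInv_mul_coeffU (k := k + 1) (by omega) (by omega) hm, Finset.sum_mul]
    refine Finset.sum_congr rfl fun i hi => ?_
    rw [Nat.add_sub_cancel' (by rw [Finset.mem_range] at hi; omega)]

theorem coeffConv_eq_sum {μ μ' : ℂ} (hμ : μ ≠ 0) {c c' : ℝ} (hc : μ ^ 2 = c) (hc' : μ' ^ 2 = c')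
    {n m k : ℕ} (hm : m ≤ n + 1) (hk : 2 * k ≤ n + 1 - m) :
    coeffConv n m k μ' μ = ∑ j ∈ Finset.range (k + 1),
      coeffU (n + 1) m j * coeffUInv (n + 1 - 2 * j) m (k - j) * (c' ^ j * c ^ (k - j)) := by
  have hc0 : c ≠ 0 := by
    rintro rfl
    exact hμ (by simpa using hc)
  rw [coeffConv, if_neg hμ, div_pow, hc, hc', ← Complex.ofReal_div, Complex.ofReal_re,
    re_pow_two_mul hc, ordinaryHypergeometric_neg_natCast, Finset.sum_mul, Finset.sum_mul]
  refine Finset.sum_congr rfl fun j hj => ?_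
  have hj' : j ≤ k := by rw [Finset.mem_range] at hj; omega
  have hpow : c ^ k = c ^ (k - j) * c ^ j := by rw [← pow_add, Nat.sub_add_cancel hj']
  rw [coeffU_mul_coeffUInv hm hk hj', hpow, div_pow]
  field_simp

theorem solidHarmonic_eq_sum_coeffConv {μ μ' : ℂ} (hμ : μ ∈ params) (hμ' : μ' ∈ params)
    (s : Parity) {n m : ℕ} (hm : m ≤ n + 1) (x : E3) :
    solidHarmonic μ' s (n + 1) m x = ∑ k ∈ Finset.range ((n + 1 - m) / 2 + 1),
      coeffConv n m k μ' μ * solidHarmonic μ s (n + 1 - 2 * k) m x := by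
  rcases eq_or_ne μ 0 with rfl | h0
  · simp only [coeffConv, if_true, coeffV]
    exact solidHarmonic_eq_sum_zero hμ' s hm x
  obtain ⟨c, hc⟩ := exists_sq_eq_ofReal hμ
  obtain ⟨c', hc'⟩ := exists_sq_eq_ofReal hμ'
  have h1 : ∀ j ∈ Finset.range ((n + 1 - m) / 2 + 1),
      (coeffU (n + 1) m j * (μ' ^ (2 * j)).re) * solidHarmonic 0 s (n + 1 - 2 * j) m x =
      ∑ i ∈ Finset.range ((n + 1 - m) / 2 + 1 - j),
        coeffU (n + 1) m j * coeffUInv (n + 1 - 2 * j) m i * (c' ^ j * c ^ i) *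
          solidHarmonic μ s (n + 1 - 2 * (j + i)) m x := by
    intro j hj
    rw [Finset.mem_range] at hj
    rw [solidHarmonic_zero_eq_sum hμ s (by omega), Finset.mul_sum,
      show (n + 1 - 2 * j - m) / 2 + 1 = (n + 1 - m) / 2 + 1 - j by omega]
    refine Finset.sum_congr rfl fun i _ => ?_
    rw [re_pow_two_mul hc, re_pow_two_mul hc',
      show n + 1 - 2 * j - 2 * i = n + 1 - 2 * (j + i) by omega]
    ring
  rw [solidHarmonic_eq_sum_zero hμ' s hm, Finset.sum_congr rfl h1,
    ← Finset.sum_range_diag_flip _ fun j i =>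
      coeffU (n + 1) m j * coeffUInv (n + 1 - 2 * j) m i * (c' ^ j * c ^ i) *
        solidHarmonic μ s (n + 1 - 2 * (j + i)) m x]
  refine Finset.sum_congr rfl fun k hk => ?_
  rw [Finset.mem_range] at hk
  rw [coeffConv_eq_sum h0 hc hc' hm (by omega), Finset.sum_mul]
  refine Finset.sum_congr rfl fun j hj => ?_
  rw [Nat.add_sub_cancel' (by rw [Finset.mem_range] at hj; omega)]

theorem monogenic_eq_sum {μ₁ μ₂ : ℂ} (hμ₂ : μ₂ ∈ params) (s : Parity) {n m : ℕ} (hm : m ≤ n + 1)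
    (a : ℕ → ℝ)
    (h : ∀ x, solidHarmonic μ₁ s (n + 1) m x = ∑ k ∈ Finset.range ((n + 1 - m) / 2 + 1),
      a k * solidHarmonic μ₂ s (n + 1 - 2 * k) m x) (x : E3) :
    monogenic μ₁ s n m x = ∑ k ∈ Finset.range ((n + 1 - m) / 2 + 1),
      a k • monogenic μ₂ s ((n : ℤ) - 2 * k) m x := by
  rw [monogenic, show ((n : ℤ) + 1).toNat = n + 1 by omega, funext h, conjDirac_sum]
  · refine Finset.sum_congr rfl fun k hk => ?_
    rw [Finset.mem_range] at hk
    -- The index n - 2k can equal -1, but n - 2k + 1 ≥ 0, so `toNat` truncates nothing.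
    rw [monogenic, show ((n : ℤ) - 2 * k + 1).toNat = n + 1 - 2 * k by omega]
  · intro k hk
    rw [Finset.mem_range] at hk
    exact differentiable_solidHarmonic hμ₂ s (by omega)

end Spheroidal

open Spheroidal
theorem mainTheorem5 (n m : ℕ) (hm : m ≤ n + 1) (s : Parity) (hs : s = Parity.minus → 1 ≤ m)
    (μ μ' : ℂ) (hμ : μ ∈ params) (hμ' : μ' ∈ params) :
    (∀ x : E3, monogenic μ s n m x =
      ∑ k ∈ Finset.range ((n + 1 - m) / 2 + 1),
        (coeffV n m k * (μ ^ (2 * k)).re) • monogenic 0 s ((n : ℤ) - 2 * k) m x) ∧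
    (∀ x : E3, monogenic 0 s n m x =
      ∑ k ∈ Finset.range ((n + 1 - m) / 2 + 1),
        (coeffVInv n m k * (μ ^ (2 * k)).re) • monogenic μ s ((n : ℤ) - 2 * k) m x) ∧
    (∀ x : E3, monogenic μ' s n m x =
      ∑ k ∈ Finset.range ((n + 1 - m) / 2 + 1),
        coeffConv n m k μ' μ • monogenic μ s ((n : ℤ) - 2 * k) m x) := by
  have h0 : (0 : ℂ) ∈ params := Or.inl ⟨0, le_rfl, one_pos, by simp⟩
  exact ⟨monogenic_eq_sum h0 s hm _ (solidHarmonic_eq_sum_zero hμ s hm),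
    monogenic_eq_sum hμ s hm _ (solidHarmonic_zero_eq_sum hμ s hm),
    monogenic_eq_sum hμ s hm _ (solidHarmonic_eq_sum_coeffConv hμ hμ' s hm)⟩
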